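/- Let $G$ be a finite simple graph with at least one edge, with vertex set $V$, let $\lambda_1\ge\dots\ge\lambda_n$ be the eigenvalues (with multiplicity) of its adjacency matrix, and for real $p\ge 0$ put $$\mathcal E_p^+(G)=\sum_{\lambda_i>0}\lambda_i^p,\qquad \mathcal E_p^-(G)=\sum_{\lambda_i<0}|\lambda_i|^p,$$ so that for $p=0$ these are the numbers of positive and of negative eigenvalues. Let $\chi(G)$ be the chromatic number of $G$, and define the following parameters. - The fractional chromatic number $\chi_f(G)$ is the minimum of $\sum_J\sigma_J$ over all assignments of weights $\sigma_J\ge 0$ to the independent sets $J$ of $G$ such that $\sum_{J\ni v}\sigma_J\ge 1$ for every vertex $v$. - The quantum chromatic number $\chi_q(G)$ is the least $r$ such that for some $d>0$ there are orthogonal projectors $P_{v,k}\in\mathbb C^{d\times d}$ ($v\in V$, $1\le k\le r$) with $\sum_k P_{v,k}=I_d$ for every $v$ and $P_{v,k}P_{w,k}=0$ for every edge $vw$ and every $k$. - The orthogonal rank $\xi(G)$ is the least positive integer $k$ such that there are non-zero vectors $x_v\in\mathbb C^k$ ($v\in V$) with $x_v^*x_w=0$ for every edge $vw$. - The projective rank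 $\xi_f(G)$ is the infimum of $d/r$ over all positive integers $d,r$ for which there are orthogonal projectors $P_v\in\mathbb C^{d\times d}$ ($v\in V$) of rank $r$ with $P_vP_w=0$ for every edge $vw$. Then each of $\chi_f(G)$, $\chi_q(G)$, $\xi(G)$ is at most $\chi(G)$ and at least $\xi_f(G)$, and for every real $p\ge 0$ with $p\ne 1$, $$\xi_f(G)\ \ge\ 1+H(p),\qquad H(p)=\max\left\{\frac{\mathcal E_p^+(G)}{\mathcal E_p^-(G)},\frac{\mathcal E_p^-(G)}{\mathcal E_p^+(G)}\right\}^{\frac1{|p-1|}}.$$ For $p=1$ the bound holds as a limit: $\lim_{p\to1}H(p)$ exists and $\xi_f(G)\ge 1+\lim_{p\to 1}H(p)$. -/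

import Mathlib

open Filter Topology

noncomputable section

namespace SpectralColoring

section Energy

variable {V : Type*} [Fintype V] [DecidableEq V] (G : SimpleGraph V) [DecidableRel G.Adj]

/-- The eigenvalues of the real adjacency matrix, listed with multiplicity. -/
def eigenvalue (i : V) : ℝ := (G.isHermitian_adjMatrix ℝ).eigenvalues i

/-- The positive `p`-energy: the sum of `λ ^ p` over the positive eigenvalues `λ`. -/
def posEnergy (p : ℝ) : ℝ :=
  ∑ i with 0 < eigenvalue G i, eigenvalue G i ^ p

/-- The negative `p`-energy: the sum of `|λ| ^ p` over the negative eigenvalues `λ`. -/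
def negEnergy (p : ℝ) : ℝ :=
  ∑ i with eigenvalue G i < 0, |eigenvalue G i| ^ p

/-- `max {E⁺ / E⁻, E⁻ / E⁺} ^ (1 / |p - 1|)`, meaningful for `p ≠ 1` and graphs with an edge. -/
def energyRatio (p : ℝ) : ℝ :=
  max (posEnergy G p / negEnergy G p) (negEnergy G p / posEnergy G p) ^ (1 / |p - 1|)

end Energy

section Parameters

variable {V : Type*} (G : SimpleGraph V)

/-- On a finite graph the value `⊤` does not occur, so `toNat` loses nothing. -/
theorem chromaticNumber_toNat_eq [Finite V] :
    (G.chromaticNumber.toNat : ℕ∞) = G.chromaticNumber := by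
  have := Fintype.ofFinite V
  exact ENat.natCast_toNat (SimpleGraph.chromaticNumber_ne_top_iff_exists.2
    ⟨_, G.colorable_of_fintype⟩)

open Classical in
/-- The independent sets of `G`. -/
def indepSets [Fintype V] : Finset (Finset V) :=
  Finset.univ.filter fun J => G.IsIndepSet (J : Set V)

open Classical in
/-- Nonnegative weights on the independent sets such that, for every vertex, the independent
sets containing it have total weight at least `1`. -/
def IsFractionalColoring [Fintype V] (σ : Finset V → ℝ) : Prop :=
  (∀ J ∈ indepSets G, 0 ≤ σ J) ∧ ∀ v : V, 1 ≤ ∑ J ∈ indepSets G with v ∈ J, σ J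

/-- The least total weight of a fractional coloring. -/
def fractionalChromaticNumber [Fintype V] : ℝ :=
  sInf {c : ℝ | ∃ σ : Finset V → ℝ, IsFractionalColoring G σ ∧ c = ∑ J ∈ indepSets G, σ J}

/-- `P` is a quantum `r`-coloring of `G` by orthogonal projectors in dimension `d`. -/
structure IsQuantumColoring (r d : ℕ) (P : V → Fin r → Matrix (Fin d) (Fin d) ℂ) : Prop where
  proj : ∀ v k, IsStarProjection (P v k)
  complete : ∀ v, ∑ k, P v k = 1
  orthogonal : ∀ v w, G.Adj v w → ∀ k, P v k * P w k = 0

/-- The least `r` such that `G` has a quantum `r`-coloring in some dimension `d > 0`. -/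
def quantumChromaticNumber : ℕ :=
  sInf {r : ℕ | ∃ d : ℕ, 0 < d ∧ ∃ P, IsQuantumColoring G r d P}

/-- Nonzero vectors of `ℂ ^ k`, orthogonal on adjacent vertices. -/
structure IsOrthogonalRepresentation (k : ℕ) (x : V → EuclideanSpace ℂ (Fin k)) : Prop where
  ne_zero : ∀ v, x v ≠ 0
  orthogonal : ∀ v w, G.Adj v w → inner ℂ (x v) (x w) = 0

/-- The least positive dimension of an orthogonal representation. -/
def orthogonalRank : ℕ :=
  sInf {k : ℕ | 0 < k ∧ ∃ x, IsOrthogonalRepresentation G k x}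

/-- A `d/r`-representation: rank-`r` orthogonal projectors of size `d`, orthogonal on adjacent
vertices. -/
structure IsProjectiveRepresentation (d r : ℕ) (P : V → Matrix (Fin d) (Fin d) ℂ) : Prop where
  proj : ∀ v, IsStarProjection (P v)
  rank_eq : ∀ v, (P v).rank = r
  orthogonal : ∀ v w, G.Adj v w → P v * P w = 0

/-- The infimum of `d / r` over all positive integers `d`, `r` for which `G` has a
`d/r`-representation. -/
def projectiveRank : ℝ :=
  sInf {c : ℝ | ∃ d r : ℕ, 0 < d ∧ 0 < r ∧ (∃ P, IsProjectiveRepresentation G d r P) ∧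
    c = (d : ℝ) / r}

end Parameters

section WellDefined

/-! The infima above are taken over nonempty sets, and those in `ℝ` over sets bounded below. -/

variable {V : Type*} [Fintype V] (G : SimpleGraph V)

theorem fractionalChromaticNumber_wellDefined :
    {c : ℝ | ∃ σ : Finset V → ℝ,
      IsFractionalColoring G σ ∧ c = ∑ J ∈ indepSets G, σ J}.Nonempty ∧
    BddBelow {c : ℝ | ∃ σ : Finset V → ℝ,
      IsFractionalColoring G σ ∧ c = ∑ J ∈ indepSets G, σ J} := by
  classical
  refine ⟨⟨_, fun _ => 1, ⟨fun _ _ => zero_le_one, fun v => ?_⟩, rfl⟩, 0, ?_⟩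
  · have h : ({v} : Finset V) ∈ (indepSets G).filter (fun J => v ∈ J) := by
      simp [indepSets, SimpleGraph.IsIndepSet]
    exact Finset.single_le_sum (f := fun _ => (1 : ℝ)) (fun _ _ => zero_le_one) h
  · rintro c ⟨σ, hσ, rfl⟩
    exact Finset.sum_nonneg hσ.1

theorem quantumChromaticNumber_wellDefined :
    {r : ℕ | ∃ d : ℕ, 0 < d ∧ ∃ P, IsQuantumColoring G r d P}.Nonempty := by
  classical
  refine ⟨Fintype.card V, 1, one_pos, fun v k => if Fintype.equivFin V v = k then 1 else 0,
    ⟨fun v k => ?_, fun v => by simp, fun v w h k => ?_⟩⟩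
  · split_ifs
    · exact IsStarProjection.one _
    · exact IsStarProjection.zero _
  · have := h.ne
    split_ifs with h1 h2
    · exact absurd ((Fintype.equivFin V).injective (h1.trans h2.symm)) this
    all_goals simp

theorem orthogonalRank_wellDefined [Nonempty V] :
    {k : ℕ | 0 < k ∧ ∃ x, IsOrthogonalRepresentation G k x}.Nonempty := by
  classical
  refine ⟨Fintype.card V, Fintype.card_pos,
    fun v => EuclideanSpace.single (Fintype.equivFin V v) 1, ⟨fun v => by simp, ?_⟩⟩
  intro v w h
  have := h.ne
  simp [EuclideanSpace.inner_single_left, this]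

theorem projectiveRank_wellDefined [Nonempty V] :
    {c : ℝ | ∃ d r : ℕ, 0 < d ∧ 0 < r ∧ (∃ P, IsProjectiveRepresentation G d r P) ∧
      c = (d : ℝ) / r}.Nonempty ∧
    BddBelow {c : ℝ | ∃ d r : ℕ, 0 < d ∧ 0 < r ∧ (∃ P, IsProjectiveRepresentation G d r P) ∧
      c = (d : ℝ) / r} := by
  classical
  refine ⟨⟨_, Fintype.card V, 1, Fintype.card_pos, one_pos,
    ⟨fun v => Matrix.diagonal (Pi.single (Fintype.equivFin V v) 1), ⟨?_, ?_, ?_⟩⟩, rfl⟩, 0, ?_⟩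
  · intro v
    refine ⟨?_, ?_⟩
    · rw [IsIdempotentElem, Matrix.diagonal_mul_diagonal]
      congr 1; ext i; by_cases h : i = Fintype.equivFin V v <;> simp [h]
    · rw [IsSelfAdjoint, Matrix.star_eq_conjTranspose, Matrix.diagonal_conjTranspose]
      congr 1; ext i; by_cases h : i = Fintype.equivFin V v <;> simp [h]
  · intro v
    rw [Matrix.rank_diagonal]
    simp [Pi.single_apply]
  · intro v w h
    have hne := h.ne
    rw [Matrix.diagonal_mul_diagonal, ← Matrix.diagonal_zero]
    congr 1; ext i
    by_cases h1 : i = Fintype.equivFin V v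
    · subst h1; simp [hne]
    · simp [Pi.single_apply, h1]
  · rintro c ⟨d, r, _, _, _, rfl⟩
    positivity

end WellDefined

end SpectralColoring

end

/-!
The comparisons among the parameters are constructions: a coloring yields a fractional coloring, a
quantum coloring and an orthogonal representation, and each of these yields projective
representations (for fractional colorings, after rounding the weights to multiples of `1 / N`).

The spectral bound is a double use of Jensen's inequality. Let `P v` be rank `r` projectors of
size `d` forming a projective representation, let `P` be their direct sum, a projector on
`ℂ ^ V ⊗ ℂ ^ d`, and split the adjacency matrix into positive and negative parts,
`A = A⁺ - A⁻`. Orthogonality along edges says that `P (A ⊗ 1) P = 0`, hence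
`D := P (A⁺ ⊗ 1) P = P (A⁻ ⊗ 1) P`. Let `f` be convex on `[0, ∞)` with `f 0 = 0`, and `s ≥ 0`.

* As `(1 + s) D` is the compression of `(A⁺ + s A⁻) ⊗ 1`, and `P` has partial trace `r`,
  `tr f ((1 + s) D) ≤ r tr f (A⁺ + s A⁻)`.
* The operator `√(A⁺ ⊗ 1) P √(A⁺ ⊗ 1)` has the nonzero spectrum of `D` and partial trace `r A⁺`,
  so `d tr f ((1 + s) (r / d) A⁺) ≤ tr f ((1 + s) D)`.

Together, `tr f ((1 + s) (r / d) A⁺) ≤ (r / d) tr f (A⁺ + s A⁻)`; this is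
`IsProjectiveRepresentation.hasConvexTraceBound`, resting on `sum_convex_le_of_projection`. For
`f t = t ^ p` with `p > 1`, and for `f t = - t ^ p` with `0 ≤ p < 1`, the choice of `s` with
`s ^ p E⁻ = s E⁺` turns it into `θ ^ p ≤ θ`, respectively `θ ≤ θ ^ p`, where
`θ = (1 + s) r / d`. So `θ ≤ 1`, that is `1 + s ≤ d / r`, and `s` is a power of an energy ratio.
The roles of `A⁺` and `A⁻` may be exchanged. The case `p = 1` is the limit
(`exists_tendsto_energyRatio`).

Everything is written in eigenbases: the overlaps `q i j` of the `i`-th eigenspace of `A ⊗ 1` with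
the image under `P` of the `j`-th eigenvector of `D` are all that the two Jensen steps need.
-/

namespace SpectralColoring

/-! ### Convexity and spectral overlaps -/


theorem convexOn_map_sum_le_of_sum_le_one {ι : Type*} {s : Finset ι} {f : ℝ → ℝ}
    (hf : ConvexOn ℝ (Set.Ici 0) f) (h0 : f 0 = 0) {w x : ι → ℝ} (hw : ∀ i ∈ s, 0 ≤ w i)
    (hw1 : ∑ i ∈ s, w i ≤ 1) (hx : ∀ i ∈ s, 0 ≤ x i) :
    f (∑ i ∈ s, w i * x i) ≤ ∑ i ∈ s, w i * f (x i) := by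
  have := hf.map_add_sum_le (t := s) (w := w) (p := x) (v := 1 - ∑ i ∈ s, w i) (q := 0) hw
    (by ring) hx (by linarith) (by simp)
  simpa [h0] using this

/-- The two Jensen steps, in coordinates. Here `l` is the spectrum of `A`, `δ` that of
`D = P (A⁺ ⊗ 1) P = P (A⁻ ⊗ 1) P`, and `q i j` is the squared norm of the component of `P φ j` in
the `i`-th eigenspace of `A ⊗ 1`, where `φ j` is the `j`-th eigenvector of `D`. Terms with
`δ j = 0` count as zero in the last hypothesis. -/
theorem sum_convex_le_of_overlaps {ι κ : Type*} [Fintype ι] [Fintype κ] {f : ℝ → ℝ}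
    (hf : ConvexOn ℝ (Set.Ici 0) f) (h0 : f 0 = 0) {l : ι → ℝ} {δ : κ → ℝ} {q : ι → κ → ℝ}
    {d r s : ℝ} (hd : 0 < d) (hs : 0 ≤ s) (hq : ∀ i j, 0 ≤ q i j)
    (hrow : ∀ i, ∑ j, q i j = r) (hcol : ∀ j, ∑ i, q i j ≤ 1)
    (hpos : ∀ j, ∑ i, max (l i) 0 * q i j = δ j) (hneg : ∀ j, ∑ i, max (-l i) 0 * q i j = δ j)
    (hbes : ∀ i, ∑ j, max (l i) 0 * q i j / δ j ≤ d) :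
    ∑ i, f ((1 + s) * (r / d) * max (l i) 0) ≤
      r / d * ∑ i, f (max (l i) 0 + s * max (-l i) 0) := by
  have hδ : ∀ j, 0 ≤ δ j := fun j => by
    rw [← hpos j]; exact Finset.sum_nonneg fun i _ => mul_nonneg (le_max_right _ _) (hq i j)
  -- a vanishing eigenvalue of the compression forces its overlaps with the positive part to vanish
  have hzero : ∀ i j, δ j = 0 → max (l i) 0 * q i j = 0 := fun i j hj => by
    have := (Finset.sum_eq_zero_iff_of_nonneg
      (fun i _ => mul_nonneg (le_max_right (l i) 0) (hq i j))).1 ((hpos j).trans hj)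
    exact this i (Finset.mem_univ i)
  have hA : ∀ i, f ((1 + s) * (r / d) * max (l i) 0) ≤
      ∑ j, max (l i) 0 * q i j / (d * δ j) * f ((1 + s) * δ j) := fun i => by
    have heq : (1 + s) * (r / d) * max (l i) 0 =
        ∑ j, max (l i) 0 * q i j / (d * δ j) * ((1 + s) * δ j) := by
      rw [← hrow i, Finset.sum_div, Finset.mul_sum, Finset.sum_mul]
      refine Finset.sum_congr rfl fun j _ => ?_
      rcases eq_or_ne (δ j) 0 with hj | hj
      · have := hzero i j hj
        rw [hj]
        linear_combination (1 + s) / d * this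
      · field_simp
    rw [heq]
    refine convexOn_map_sum_le_of_sum_le_one hf h0 (fun j _ => ?_) ?_ fun j _ => ?_
    · exact div_nonneg (mul_nonneg (le_max_right _ _) (hq i j)) (mul_nonneg hd.le (hδ j))
    · have : ∑ j, max (l i) 0 * q i j / (d * δ j) = (∑ j, max (l i) 0 * q i j / δ j) / d := by
        rw [Finset.sum_div]
        exact Finset.sum_congr rfl fun j _ => by rw [div_div, mul_comm d]
      rw [this]
      exact (div_le_one hd).2 (hbes i)
    · exact mul_nonneg (by linarith) (hδ j)
  have hB : ∀ j, f ((1 + s) * δ j) ≤ ∑ i, q i j * f (max (l i) 0 + s * max (-l i) 0) := fun j => by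
    have heq : (1 + s) * δ j = ∑ i, q i j * (max (l i) 0 + s * max (-l i) 0) := by
      have : (1 + s) * δ j = δ j + s * δ j := by ring
      rw [this]
      nth_rewrite 1 [← hpos j]
      rw [← hneg j, Finset.mul_sum, ← Finset.sum_add_distrib]
      exact Finset.sum_congr rfl fun i _ => by ring
    rw [heq]
    exact convexOn_map_sum_le_of_sum_le_one hf h0 (fun i _ => hq i j) (hcol j)
      fun i _ => add_nonneg (le_max_right _ _) (mul_nonneg hs (le_max_right _ _))
  calc ∑ i, f ((1 + s) * (r / d) * max (l i) 0)
      ≤ ∑ i, ∑ j, max (l i) 0 * q i j / (d * δ j) * f ((1 + s) * δ j) :=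
        Finset.sum_le_sum fun i _ => hA i
    _ = ∑ j, 1 / d * f ((1 + s) * δ j) := by
        rw [Finset.sum_comm]
        refine Finset.sum_congr rfl fun j _ => ?_
        rw [← Finset.sum_mul, ← Finset.sum_div, hpos j]
        rcases eq_or_ne (δ j) 0 with hj | hj
        · simp [hj, h0]
        · field_simp
    _ ≤ ∑ j, 1 / d * ∑ i, q i j * f (max (l i) 0 + s * max (-l i) 0) :=
        Finset.sum_le_sum fun j _ => mul_le_mul_of_nonneg_left (hB j) (by positivity)
    _ = r / d * ∑ i, f (max (l i) 0 + s * max (-l i) 0) := by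
        rw [← Finset.mul_sum, Finset.sum_comm]
        simp_rw [← Finset.sum_mul, hrow]
        rw [← Finset.mul_sum]
        ring

/-! ### Compressions to a subspace -/

section Operator

variable {E : Type*} [NormedAddCommGroup E] [InnerProductSpace ℂ E]

/-- The compression `P (∑ m, c m |b m⟩⟨b m|) P` of a diagonal operator. -/
noncomputable def compression {μ : Type*} [Fintype μ] (P : E →ₗ[ℂ] E) (b : μ → E) (c : μ → ℝ) :
    E →ₗ[ℂ] E :=
  ∑ m, (c m : ℂ) • P ∘ₗ ((innerSL ℂ (b m)).toLinearMap.smulRight (b m)) ∘ₗ P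

theorem compression_apply {μ : Type*} [Fintype μ] (P : E →ₗ[ℂ] E) (b : μ → E) (c : μ → ℝ) (x : E) :
    compression P b c x = ∑ m, ((c m : ℂ) * inner ℂ (b m) (P x)) • P (b m) := by
  simp [compression, mul_smul]

theorem inner_compression {μ : Type*} [Fintype μ] {P : E →ₗ[ℂ] E} (hP : P.IsSymmetric)
    (b : μ → E) (c : μ → ℝ) (x y : E) :
    inner ℂ y (compression P b c x) =
      ∑ m, (c m : ℂ) * (inner ℂ (b m) (P x) * inner ℂ (P y) (b m)) := by
  rw [compression_apply, inner_sum]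
  refine Finset.sum_congr rfl fun m _ => ?_
  rw [inner_smul_right, ← hP y (b m), mul_assoc]

theorem inner_compression_self {μ : Type*} [Fintype μ] {P : E →ₗ[ℂ] E} (hP : P.IsSymmetric)
    (b : μ → E) (c : μ → ℝ) (x : E) :
    inner ℂ x (compression P b c x) = ((∑ m, c m * ‖inner ℂ (b m) (P x)‖ ^ 2 : ℝ) : ℂ) := by
  rw [inner_compression hP]
  push_cast
  refine Finset.sum_congr rfl fun m _ => ?_
  rw [← inner_conj_symm (P x) (b m), Complex.mul_conj']

theorem isSymmetric_compression {μ : Type*} [Fintype μ] {P : E →ₗ[ℂ] E} (hP : P.IsSymmetric)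
    (b : μ → E) (c : μ → ℝ) : (compression P b c).IsSymmetric := by
  intro x y
  rw [← inner_conj_symm, inner_compression hP, inner_compression hP, map_sum]
  refine Finset.sum_congr rfl fun m _ => ?_
  simp only [map_mul, inner_conj_symm, Complex.conj_ofReal]
  ring

theorem eigenvalue_compression_eq {μ : Type*} [Fintype μ] {P : E →ₗ[ℂ] E} (hP : P.IsSymmetric)
    (b : μ → E) (c : μ → ℝ) {x : E} {δ : ℝ} (hx : ‖x‖ = 1)
    (h : compression P b c x = (δ : ℂ) • x) :
    δ = ∑ m, c m * ‖inner ℂ (b m) (P x)‖ ^ 2 := by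
  have h' := inner_compression_self hP b c x
  rw [h, inner_smul_right, inner_self_eq_norm_sq_to_K, hx] at h'
  simp only [RCLike.ofReal_one, one_pow, mul_one] at h'
  exact Complex.ofReal_injective h'

/-- If `D` dominates `c |P b⟩⟨P b|`, then `c ⟨P b, D⁻¹ P b⟩ ≤ 1`, where `D⁻¹` is the
Moore-Penrose inverse. It follows on evaluating the form of `D` at `D⁻¹ P b`. -/
theorem compression_sum_div_eigenvalue_le_one {μ κ : Type*} [Fintype μ] [Fintype κ]
    {P : E →ₗ[ℂ] E} (hP : P.IsSymmetric) (b : μ → E) {c : μ → ℝ} (hc : ∀ m, 0 ≤ c m)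
    (φ : OrthonormalBasis κ ℂ E) {δ : κ → ℝ}
    (hφ : ∀ j, compression P b c (φ j) = (δ j : ℂ) • φ j) (m : μ) :
    ∑ j, c m * ‖inner ℂ (b m) (P (φ j))‖ ^ 2 / δ j ≤ 1 := by
  have hδ : ∀ j, 0 ≤ δ j := fun j => by
    rw [eigenvalue_compression_eq hP b c (φ.norm_eq_one j) (hφ j)]
    exact Finset.sum_nonneg fun m _ => mul_nonneg (hc m) (by positivity)
  set g : κ → ℂ := fun j => inner ℂ (b m) (P (φ j)) with hg
  set t : ℝ := ∑ j, ‖g j‖ ^ 2 / δ j with ht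
  have ht0 : 0 ≤ t := Finset.sum_nonneg fun j _ => div_nonneg (by positivity) (hδ j)
  set z : E := ∑ j, ((starRingEnd ℂ) (g j) / (δ j : ℂ)) • φ j with hz
  have h1 : inner ℂ (b m) (P z) = (t : ℂ) := by
    rw [hz, map_sum, inner_sum, ht]
    push_cast
    refine Finset.sum_congr rfl fun j _ => ?_
    rw [map_smul, inner_smul_right, div_mul_eq_mul_div]
    congr 1
    exact Complex.conj_mul' (g j)
  have h2 : inner ℂ z (compression P b c z) = (t : ℂ) := by
    have : compression P b c z = ∑ j, ((starRingEnd ℂ) (g j) / (δ j : ℂ) * δ j) • φ j := by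
      rw [hz, map_sum]
      exact Finset.sum_congr rfl fun j _ => by rw [map_smul, hφ, smul_smul]
    rw [this, hz, φ.orthonormal.inner_sum, ht]
    push_cast
    refine Finset.sum_congr rfl fun j _ => ?_
    rw [map_div₀, Complex.conj_ofReal, Complex.conj_conj, ← Complex.mul_conj']
    rcases eq_or_ne (δ j) 0 with hj | hj
    · simp [hj]
    · have : (δ j : ℂ) ≠ 0 := by exact_mod_cast hj
      field_simp
  have h3 : c m * t ^ 2 ≤ t := by
    rw [inner_compression_self hP] at h2
    have h2' : ∑ n, c n * ‖inner ℂ (b n) (P z)‖ ^ 2 = t := by exact_mod_cast h2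
    calc c m * t ^ 2 = c m * ‖inner ℂ (b m) (P z)‖ ^ 2 := by
          rw [h1, Complex.norm_real, Real.norm_eq_abs, sq_abs]
      _ ≤ ∑ n, c n * ‖inner ℂ (b n) (P z)‖ ^ 2 :=
          Finset.single_le_sum (f := fun n => c n * ‖inner ℂ (b n) (P z)‖ ^ 2)
            (fun n _ => mul_nonneg (hc n) (by positivity)) (Finset.mem_univ m)
      _ = t := h2'
  have h4 : ∑ j, c m * ‖inner ℂ (b m) (P (φ j))‖ ^ 2 / δ j = c m * t := by
    rw [ht, Finset.mul_sum]
    exact Finset.sum_congr rfl fun j _ => by rw [mul_div_assoc]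
  rw [h4]
  rcases ht0.eq_or_lt with h | h
  · simp [← h]
  · nlinarith

/-- The trace inequality carrying the spectral bound. `P` is an orthogonal projection onto a
subspace on which the form `∑ l i |⟨b (a, i), x⟩|²` vanishes, having the same
overlap `r` with the span of `b (·, i)` for every `i`. -/
theorem sum_convex_le_of_projection [FiniteDimensional ℂ E] {ι κ : Type*} [Fintype ι] [Fintype κ]
    [Nonempty κ] {f : ℝ → ℝ} (hf : ConvexOn ℝ (Set.Ici 0) f) (h0 : f 0 = 0) {l : ι → ℝ}
    {P : E →ₗ[ℂ] E} (hP : P.IsSymmetric) (hPP : ∀ x, P (P x) = P x) {b : κ × ι → E}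
    (hb : Orthonormal ℂ b) {r s : ℝ} (hs : 0 ≤ s)
    (hr : ∀ i, ∑ a, ‖P (b (a, i))‖ ^ 2 = r)
    (hl : ∀ x, ∑ m : κ × ι, l m.2 * ‖inner ℂ (b m) (P x)‖ ^ 2 = 0) :
    ∑ i, f ((1 + s) * (r / Fintype.card κ) * max (l i) 0) ≤
      r / Fintype.card κ * ∑ i, f (max (l i) 0 + s * max (-l i) 0) := by
  set c : κ × ι → ℝ := fun m => max (l m.2) 0 with hc
  have hsym := isSymmetric_compression hP b c
  set φ := hsym.eigenvectorBasis rfl with hφ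
  set δ := hsym.eigenvalues rfl with hδ
  have heig : ∀ j, compression P b c (φ j) = (δ j : ℂ) • φ j := hsym.apply_eigenvectorBasis rfl
  have hsplit : ∀ (g : ι → ℝ) (F : κ × ι → ℝ), ∑ m : κ × ι, g m.2 * F m =
      ∑ i, g i * ∑ a, F (a, i) := fun g F => by
    simp_rw [Fintype.sum_prod_type_right, Finset.mul_sum]
  have hpos : ∀ j, ∑ i, max (l i) 0 * ∑ a, ‖inner ℂ (b (a, i)) (P (φ j))‖ ^ 2 = δ j := fun j => by
    rw [eigenvalue_compression_eq hP b c (φ.norm_eq_one j) (heig j)]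
    exact (hsplit (fun i => max (l i) 0) fun m => ‖inner ℂ (b m) (P (φ j))‖ ^ 2).symm
  refine sum_convex_le_of_overlaps hf h0 (δ := δ)
    (q := fun i j => ∑ a, ‖inner ℂ (b (a, i)) (P (φ j))‖ ^ 2) (by positivity) hs
    (fun i j => by positivity) (fun i => ?_) (fun j => ?_) hpos (fun j => ?_) (fun i => ?_)
  · rw [Finset.sum_comm, ← hr i]
    refine Finset.sum_congr rfl fun a _ => ?_
    simp_rw [← hP (b (a, i))]
    exact φ.sum_sq_norm_inner_left _
  · rw [← Fintype.sum_prod_type_right (fun m : κ × ι => ‖inner ℂ (b m) (P (φ j))‖ ^ 2)]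
    refine (hb.sum_inner_products_le (P (φ j))).trans ?_
    have h1 : ‖P (φ j)‖ ^ 2 = RCLike.re (inner ℂ (φ j) (P (φ j))) := by
      rw [← inner_self_eq_norm_sq (𝕜 := ℂ), hP, hPP]
    have h2 : RCLike.re (inner ℂ (φ j) (P (φ j))) ≤ ‖P (φ j)‖ := by
      have := re_inner_le_norm (𝕜 := ℂ) (φ j) (P (φ j))
      rwa [φ.norm_eq_one, one_mul] at this
    have := norm_nonneg (P (φ j))
    nlinarith
  · rw [← hpos j]
    have h := hl (φ j)
    rw [hsplit l fun m => ‖inner ℂ (b m) (P (φ j))‖ ^ 2] at h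
    have hl' : ∀ i, l i = max (l i) 0 - max (-l i) 0 := fun i => by
      rcases le_total (l i) 0 with h | h <;> simp [h]
    have h' : ∑ i, (max (l i) 0 - max (-l i) 0) * ∑ a, ‖inner ℂ (b (a, i)) (P (φ j))‖ ^ 2 = 0 := by
      simpa only [← hl'] using h
    simp_rw [sub_mul, Finset.sum_sub_distrib] at h'
    exact (sub_eq_zero.1 h').symm
  · calc ∑ j, max (l i) 0 * (∑ a, ‖inner ℂ (b (a, i)) (P (φ j))‖ ^ 2) / δ j
        = ∑ a, ∑ j, c (a, i) * ‖inner ℂ (b (a, i)) (P (φ j))‖ ^ 2 / δ j := by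
          rw [Finset.sum_comm]
          exact Finset.sum_congr rfl fun j _ => by rw [Finset.mul_sum, Finset.sum_div]
      _ ≤ ∑ a : κ, 1 := Finset.sum_le_sum fun a _ =>
          compression_sum_div_eigenvalue_le_one hP b (fun m => le_max_right _ _) φ heig (a, i)
      _ = Fintype.card κ := by simp

end Operator

/-! ### Power functions and energies -/


/-- The power `t ^ p` on `[0, ∞)`, with value `0` at `0` also for `p = 0`, where it is the
indicator of the positive numbers. -/
noncomputable def zeroPow (p t : ℝ) : ℝ := if t = 0 then 0 else t ^ p

theorem zeroPow_zero (p : ℝ) : zeroPow p 0 = 0 := if_pos rfl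

theorem zeroPow_of_pos (p : ℝ) {t : ℝ} (ht : 0 < t) : zeroPow p t = t ^ p := if_neg ht.ne'

theorem zeroPow_eq_rpow {p : ℝ} (hp : p ≠ 0) : zeroPow p = fun t => t ^ p := by
  ext t
  rcases eq_or_ne t 0 with rfl | h
  · rw [zeroPow_zero, Real.zero_rpow hp]
  · exact if_neg h

theorem zeroPow_mul (p : ℝ) {a t : ℝ} (ha : 0 < a) (ht : 0 ≤ t) :
    zeroPow p (a * t) = a ^ p * zeroPow p t := by
  rcases ht.eq_or_lt with rfl | ht
  · simp [zeroPow_zero]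
  · rw [zeroPow_of_pos p ht, zeroPow_of_pos p (mul_pos ha ht), Real.mul_rpow ha.le ht.le]

theorem convexOn_zeroPow {p : ℝ} (hp : 1 < p) : ConvexOn ℝ (Set.Ici 0) (zeroPow p) := by
  rw [zeroPow_eq_rpow (by linarith)]
  exact convexOn_rpow hp.le

theorem concaveOn_zeroPow {p : ℝ} (hp0 : 0 ≤ p) (hp : p ≤ 1) :
    ConcaveOn ℝ (Set.Ici 0) (zeroPow p) := by
  rcases hp0.eq_or_lt with rfl | hp0
  · refine ⟨convex_Ici 0, fun x hx y hy a b ha hb hab => ?_⟩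
    rw [Set.mem_Ici] at hx hy
    simp only [zeroPow, Real.rpow_zero, smul_eq_mul]
    have := mul_nonneg ha hx
    have := mul_nonneg hb hy
    have hle : ∀ c t : ℝ, 0 ≤ c → c * (if t = 0 then 0 else 1) ≤ c := fun c t hc => by
      split_ifs <;> simp [hc]
    have hzero : ∀ c t : ℝ, c * t = 0 → c * (if t = 0 then (0 : ℝ) else 1) = 0 := fun c t h => by
      rcases mul_eq_zero.1 h with h | h <;> simp [h]
    by_cases hz : a * x + b * y = 0
    · rw [hzero a x (by linarith), hzero b y (by linarith), if_pos hz, add_zero]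
    · rw [if_neg hz]
      linarith [hle a x ha, hle b y hb]
  · rw [zeroPow_eq_rpow hp0.ne']
    exact Real.concaveOn_rpow hp0.le hp

/-- The sum of `t ^ p` over the positive members `t` of a finite family of reals. -/
noncomputable def posPowSum {ι : Type*} [Fintype ι] (l : ι → ℝ) (p : ℝ) : ℝ :=
  ∑ i with 0 < l i, l i ^ p

theorem sum_zeroPow_max {ι : Type*} [Fintype ι] (l : ι → ℝ) (p : ℝ) :
    ∑ i, zeroPow p (max (l i) 0) = posPowSum l p := by
  rw [posPowSum, Finset.sum_filter]
  refine Finset.sum_congr rfl fun i _ => ?_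
  split_ifs with h
  · rw [max_eq_left h.le, zeroPow_of_pos p h]
  · rw [max_eq_right (not_lt.1 h), zeroPow_zero]

theorem posPowSum_pos {ι : Type*} [Fintype ι] {l : ι → ℝ} (h : ∃ i, 0 < l i) (p : ℝ) :
    0 < posPowSum l p := by
  obtain ⟨i, hi⟩ := h
  exact Finset.sum_pos (fun j hj => Real.rpow_pos_of_pos (Finset.mem_filter.1 hj).2 p)
    ⟨i, by simp [hi]⟩

/-- The family `l` satisfies the convex trace inequality with ratio `ρ`, for all convex
functions on `[0, ∞)` vanishing at `0`. -/
def HasConvexTraceBound {ι : Type*} [Fintype ι] (l : ι → ℝ) (ρ : ℝ) : Prop :=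
  ∀ f : ℝ → ℝ, ConvexOn ℝ (Set.Ici 0) f → f 0 = 0 → ∀ s : ℝ, 0 ≤ s →
    ∑ i, f ((1 + s) * ρ * max (l i) 0) ≤ ρ * ∑ i, f (max (l i) 0 + s * max (-l i) 0)

theorem sum_zeroPow_max_add {ι : Type*} [Fintype ι] (l : ι → ℝ) (p : ℝ) {s : ℝ} (hs : 0 < s) :
    ∑ i, zeroPow p (max (l i) 0 + s * max (-l i) 0) =
      posPowSum l p + s ^ p * posPowSum (-l) p := by
  rw [← sum_zeroPow_max, ← sum_zeroPow_max, Finset.mul_sum, ← Finset.sum_add_distrib]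
  refine Finset.sum_congr rfl fun i _ => ?_
  rw [Pi.neg_apply, ← zeroPow_mul p hs (le_max_right _ _)]
  rcases le_total (l i) 0 with h | h <;> simp [h, zeroPow_zero]

theorem sum_zeroPow_mul_max {ι : Type*} [Fintype ι] (l : ι → ℝ) (p : ℝ) {a : ℝ} (ha : 0 < a) :
    ∑ i, zeroPow p (a * max (l i) 0) = a ^ p * posPowSum l p := by
  rw [← sum_zeroPow_max, Finset.mul_sum]
  exact Finset.sum_congr rfl fun i _ => zeroPow_mul p ha (le_max_right _ _)

theorem HasConvexTraceBound.one_add_rpow_le_of_one_lt {ι : Type*} [Fintype ι] {l : ι → ℝ}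
    {ρ p : ℝ} (h : HasConvexTraceBound l ρ) (hρ : 0 < ρ) (hp : 1 < p)
    (hx : 0 < posPowSum l p) (hy : 0 < posPowSum (-l) p) :
    1 + (posPowSum l p / posPowSum (-l) p) ^ (1 / (p - 1)) ≤ 1 / ρ := by
  set x := posPowSum l p
  set y := posPowSum (-l) p
  -- this `s` balances the two terms on the right: `s ^ p * y = s * x`
  set s := (x / y) ^ (1 / (p - 1)) with hs
  have hs0 : 0 < s := Real.rpow_pos_of_pos (div_pos hx hy) _
  have hsp : s ^ p * y = s * x := by
    have h1 : s ^ (p - 1) = x / y := by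
      rw [hs, ← Real.rpow_mul (div_pos hx hy).le, one_div_mul_cancel (by linarith), Real.rpow_one]
    rw [Real.rpow_sub_one hs0.ne'] at h1
    field_simp at h1
    linarith
  have hθ : 0 < (1 + s) * ρ := by positivity
  have key := h _ (convexOn_zeroPow hp) (zeroPow_zero p) s hs0.le
  rw [sum_zeroPow_mul_max l p hθ, sum_zeroPow_max_add l p hs0, hsp] at key
  have key' : ((1 + s) * ρ) ^ p ≤ ((1 + s) * ρ) ^ (1 : ℝ) := by
    rw [Real.rpow_one]
    refine le_of_mul_le_mul_right (key.trans_eq ?_) hx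
    ring
  rw [le_div_iff₀ hρ]
  by_contra! hlt
  exact absurd key' (not_le.2 (Real.rpow_lt_rpow_of_exponent_lt hlt hp))

theorem HasConvexTraceBound.one_add_rpow_le_of_lt_one {ι : Type*} [Fintype ι] {l : ι → ℝ}
    {ρ p : ℝ} (h : HasConvexTraceBound l ρ) (hρ : 0 < ρ) (hp0 : 0 ≤ p) (hp : p < 1)
    (hx : 0 < posPowSum l p) (hy : 0 < posPowSum (-l) p) :
    1 + (posPowSum (-l) p / posPowSum l p) ^ (1 / (1 - p)) ≤ 1 / ρ := by
  set x := posPowSum l p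
  set y := posPowSum (-l) p
  -- this `s` balances the two terms on the right: `s ^ p * y = s * x`
  set s := (y / x) ^ (1 / (1 - p)) with hs
  have hs0 : 0 < s := Real.rpow_pos_of_pos (div_pos hy hx) _
  have hsp : s ^ p * y = s * x := by
    have h1 : s ^ (1 - p) = y / x := by
      rw [hs, ← Real.rpow_mul (div_pos hy hx).le, one_div_mul_cancel (by linarith), Real.rpow_one]
    rw [Real.rpow_sub hs0, Real.rpow_one] at h1
    have := Real.rpow_pos_of_pos hs0 p
    field_simp at h1
    linarith
  have hθ : 0 < (1 + s) * ρ := by positivity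
  have key := h _ (concaveOn_zeroPow hp0 hp.le).neg (by simp [zeroPow_zero]) s hs0.le
  simp only [Pi.neg_apply, Finset.sum_neg_distrib] at key
  rw [sum_zeroPow_mul_max l p hθ, sum_zeroPow_max_add l p hs0, hsp] at key
  have key' : ((1 + s) * ρ) ^ (1 : ℝ) ≤ ((1 + s) * ρ) ^ p := by
    rw [Real.rpow_one]
    refine le_of_mul_le_mul_right (?_ : _ * x ≤ _ * x) hx
    linarith
  rw [le_div_iff₀ hρ]
  by_contra! hlt
  exact absurd key' (not_le.2 (Real.rpow_lt_rpow_of_exponent_lt hlt hp))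

theorem HasConvexTraceBound.one_add_max_rpow_le {ι : Type*} [Fintype ι] {l : ι → ℝ} {ρ p : ℝ}
    (h : HasConvexTraceBound l ρ) (h' : HasConvexTraceBound (-l) ρ) (hρ : 0 < ρ) (hp0 : 0 ≤ p)
    (hp : p ≠ 1) (hx : 0 < posPowSum l p) (hy : 0 < posPowSum (-l) p) :
    1 + max (posPowSum l p / posPowSum (-l) p) (posPowSum (-l) p / posPowSum l p) ^
      (1 / |p - 1|) ≤ 1 / ρ := by
  rw [Real.rpow_max (div_pos hx hy).le (div_pos hy hx).le (by positivity), ← max_add_add_left]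
  have hxx : 0 < posPowSum (- -l) p := by rwa [neg_neg]
  rcases lt_or_gt_of_ne hp with hp | hp
  · rw [abs_of_neg (by linarith), neg_sub]
    have h2 := h'.one_add_rpow_le_of_lt_one hρ hp0 hp hy hxx
    rw [neg_neg] at h2
    exact max_le h2 (h.one_add_rpow_le_of_lt_one hρ hp0 hp hx hy)
  · rw [abs_of_pos (by linarith)]
    have h2 := h'.one_add_rpow_le_of_one_lt hρ hp hy hxx
    rw [neg_neg] at h2
    exact max_le (h.one_add_rpow_le_of_one_lt hρ hp hx hy) h2

/-! ### The energies of a graph and their behaviour near exponent one -/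

section Energies

variable {V : Type*} [Fintype V] [DecidableEq V] (G : SimpleGraph V) [DecidableRel G.Adj]

theorem posEnergy_eq_posPowSum (p : ℝ) : posEnergy G p = posPowSum (eigenvalue G) p := rfl

theorem negEnergy_eq_posPowSum (p : ℝ) : negEnergy G p = posPowSum (-eigenvalue G) p := by
  simp only [negEnergy, posPowSum, Pi.neg_apply, Left.neg_pos_iff]
  refine Finset.sum_congr rfl fun i hi => ?_
  rw [abs_of_neg (Finset.mem_filter.1 hi).2]

theorem sum_eigenvalue : ∑ i, eigenvalue G i = 0 := by
  have := (G.isHermitian_adjMatrix ℝ).trace_eq_sum_eigenvalues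
  rw [SimpleGraph.trace_adjMatrix] at this
  exact this.symm

theorem eigenvalue_ne_zero (hG : G ≠ ⊥) : eigenvalue G ≠ 0 := by
  intro h
  have h0 := (G.isHermitian_adjMatrix ℝ).eigenvalues_eq_zero_iff.1 h
  obtain ⟨v, w, hvw⟩ := SimpleGraph.ne_bot_iff_exists_adj.1 hG
  have := congrFun (congrFun h0 v) w
  simp [SimpleGraph.adjMatrix_apply, hvw] at this

theorem exists_eigenvalue_pos (hG : G ≠ ⊥) : ∃ i, 0 < eigenvalue G i := by
  by_contra! h
  exact eigenvalue_ne_zero G hG (funext fun i =>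
    (Finset.sum_eq_zero_iff_of_nonpos fun i _ => h i).1 (sum_eigenvalue G) i (Finset.mem_univ i))

theorem exists_eigenvalue_neg (hG : G ≠ ⊥) : ∃ i, eigenvalue G i < 0 := by
  by_contra! h
  exact eigenvalue_ne_zero G hG (funext fun i =>
    (Finset.sum_eq_zero_iff_of_nonneg fun i _ => h i).1 (sum_eigenvalue G) i (Finset.mem_univ i))

theorem posEnergy_pos (hG : G ≠ ⊥) (p : ℝ) : 0 < posEnergy G p :=
  posPowSum_pos (exists_eigenvalue_pos G hG) p

theorem negEnergy_pos (hG : G ≠ ⊥) (p : ℝ) : 0 < negEnergy G p := by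
  rw [negEnergy_eq_posPowSum]
  obtain ⟨i, hi⟩ := exists_eigenvalue_neg G hG
  exact posPowSum_pos ⟨i, by simpa using hi⟩ p

theorem posEnergy_one_eq_negEnergy_one : posEnergy G 1 = negEnergy G 1 := by
  have h := sum_eigenvalue G
  have hl : ∀ x : ℝ, x = max x 0 - max (-x) 0 := fun x => by
    rcases le_total x 0 with h | h <;> simp [h]
  rw [Finset.sum_congr rfl fun i _ => hl (eigenvalue G i), Finset.sum_sub_distrib] at h
  rw [posEnergy_eq_posPowSum, negEnergy_eq_posPowSum, ← sum_zeroPow_max, ← sum_zeroPow_max,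
    zeroPow_eq_rpow one_ne_zero]
  simpa only [Real.rpow_one, Pi.neg_apply] using sub_eq_zero.1 h

theorem differentiableAt_posPowSum {ι : Type*} [Fintype ι] (l : ι → ℝ) (p : ℝ) :
    DifferentiableAt ℝ (posPowSum l) p := by
  unfold posPowSum
  refine DifferentiableAt.fun_sum fun i hi => ?_
  exact ((hasDerivAt_id p).const_rpow (Finset.mem_filter.1 hi).2).differentiableAt

theorem max_div_div_rpow_eq_exp {x y : ℝ} (hx : 0 < x) (hy : 0 < y) (t : ℝ) :
    max (x / y) (y / x) ^ t = Real.exp (|Real.log x - Real.log y| * t) := by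
  rw [Real.rpow_def_of_pos (lt_max_of_lt_left (div_pos hx hy)), abs_eq_max_neg, neg_sub,
    ← Real.log_div hx.ne' hy.ne', ← Real.log_div hy.ne' hx.ne',
    (Real.strictMonoOn_log.monotoneOn).map_max (div_pos hx hy) (div_pos hy hx)]

/-- Off `p = 1` the ratio is the exponential of the absolute slope between `1` and `p` of
`log E⁺ - log E⁻`, a function vanishing at `1` because the adjacency matrix is traceless. -/
theorem exists_tendsto_energyRatio (hG : G ≠ ⊥) :
    ∃ L : ℝ, Tendsto (energyRatio G) (𝓝[≠] 1) (𝓝 L) := by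
  set g : ℝ → ℝ := fun p => Real.log (posEnergy G p) - Real.log (negEnergy G p) with hg
  have hd : DifferentiableAt ℝ g 1 := by
    refine DifferentiableAt.sub (DifferentiableAt.log ?_ (posEnergy_pos G hG 1).ne')
      (DifferentiableAt.log ?_ (negEnergy_pos G hG 1).ne')
    · exact differentiableAt_posPowSum _ 1
    · rw [show negEnergy G = posPowSum (-eigenvalue G) from funext (negEnergy_eq_posPowSum G)]
      exact differentiableAt_posPowSum _ 1
  have hg1 : g 1 = 0 := by rw [hg]; simp [posEnergy_one_eq_negEnergy_one]
  refine ⟨Real.exp |deriv g 1|, ?_⟩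
  have ht := (hasDerivAt_iff_tendsto_slope.1 hd.hasDerivAt).abs.rexp
  refine ht.congr fun p => ?_
  rw [energyRatio, max_div_div_rpow_eq_exp (posEnergy_pos G hG p) (negEnergy_pos G hG p),
    slope_def_field, hg1, sub_zero, abs_div, mul_one_div]

end Energies

/-! ### Projective representations and the adjacency matrix -/


theorem trace_eq_rank_of_isStarProjection {α : Type*} [Fintype α] [DecidableEq α]
    {P : Matrix α α ℂ} (hP : IsStarProjection P) : P.trace = P.rank := by
  have h : IsIdempotentElem (Matrix.toLin' P) := by
    rw [IsIdempotentElem, Module.End.mul_eq_comp, ← Matrix.toLin'_mul, hP.isIdempotentElem.eq]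
  rw [← Matrix.trace_toLin'_eq, (LinearMap.IsIdempotentElem.isProj_range _ h).trace, Matrix.rank]
  rfl

theorem sum_norm_sq_eq_trace_of_isStarProjection {α : Type*} [Fintype α] {P : Matrix α α ℂ}
    (hP : IsStarProjection P) : ((∑ c, ∑ a, ‖P c a‖ ^ 2 : ℝ) : ℂ) = P.trace := by
  conv_rhs => rw [← hP.isIdempotentElem.eq, Matrix.trace]
  push_cast
  refine Finset.sum_congr rfl fun c _ => ?_
  rw [Matrix.diag_apply, Matrix.mul_apply]
  refine Finset.sum_congr rfl fun a _ => ?_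
  have : P a c = star (P c a) := by
    conv_lhs => rw [← hP.isSelfAdjoint.star_eq, Matrix.star_apply]
  rw [this, ← Complex.mul_conj']
  rfl

section Representation

variable {V : Type*} [Fintype V] [DecidableEq V] (G : SimpleGraph V) [DecidableRel G.Adj]

/-- The entry at vertex `v` of the real unit eigenvector number `i` of the adjacency matrix. -/
noncomputable def eigenvectorEntry (v i : V) : ℝ :=
  (G.isHermitian_adjMatrix ℝ).eigenvectorUnitary.1 v i

theorem sum_eigenvectorEntry_mul (i j : V) :
    ∑ v, eigenvectorEntry G v i * eigenvectorEntry G v j = if i = j then 1 else 0 := by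
  have h := congrFun (congrFun
    (Matrix.mem_unitaryGroup_iff'.1 (G.isHermitian_adjMatrix ℝ).eigenvectorUnitary.2) i) j
  rw [Matrix.mul_apply, Matrix.one_apply] at h
  simp only [Matrix.star_apply, star_trivial] at h
  exact h

theorem sum_eigenvalue_mul_eigenvectorEntry (v w : V) :
    ∑ i, eigenvalue G i * (eigenvectorEntry G v i * eigenvectorEntry G w i) =
      if G.Adj v w then 1 else 0 := by
  have h := congrFun (congrFun (G.isHermitian_adjMatrix ℝ).spectral_theorem v) w
  rw [SimpleGraph.adjMatrix_apply, Unitary.conjStarAlgAut_apply, Matrix.mul_apply] at h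
  rw [h]
  refine Finset.sum_congr rfl fun i _ => ?_
  rw [Matrix.mul_diagonal, Matrix.star_apply]
  simp only [eigenvalue, eigenvectorEntry, Function.comp_apply, star_trivial,
    RCLike.ofReal_real_eq_id, id_eq]
  ring

/-- The vectors `e_a ⊗ u_i`, where `u_i` are the eigenvectors of the adjacency matrix. -/
noncomputable def tensorEigenvector (d : ℕ) (m : Fin d × V) : EuclideanSpace ℂ (Fin d × V) :=
  WithLp.toLp 2 fun n => if n.1 = m.1 then (eigenvectorEntry G n.2 m.2 : ℂ) else 0

theorem inner_tensorEigenvector {d : ℕ} (a : Fin d) (i : V) (y : EuclideanSpace ℂ (Fin d × V)) :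
    inner ℂ (tensorEigenvector G d (a, i)) y = ∑ v, (eigenvectorEntry G v i : ℂ) * y (a, v) := by
  simp only [tensorEigenvector, PiLp.inner_apply, RCLike.inner_apply, Fintype.sum_prod_type_right]
  refine Finset.sum_congr rfl fun v _ => ?_
  rw [Finset.sum_eq_single a]
  · simp [mul_comm]
  · intro c _ hc; simp [hc]
  · simp

theorem orthonormal_tensorEigenvector (d : ℕ) : Orthonormal ℂ (tensorEigenvector G d) := by
  rw [orthonormal_iff_ite]
  rintro ⟨a, i⟩ ⟨c, j⟩
  rw [inner_tensorEigenvector]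
  simp only [tensorEigenvector, Prod.mk.injEq]
  by_cases hac : a = c
  · have := sum_eigenvectorEntry_mul G i j
    simp only [hac, if_true, true_and]
    have h := congrArg Complex.ofReal this
    rw [Complex.ofReal_sum] at h
    simp only [Complex.ofReal_mul] at h
    rw [h]
    split_ifs <;> simp
  · simp [hac]

variable {G}

/-- The block diagonal operator acting as `P v` on the copy of `ℂ ^ d` at the vertex `v`. -/
noncomputable def blockOperator {d : ℕ} (P : V → Matrix (Fin d) (Fin d) ℂ) :
    EuclideanSpace ℂ (Fin d × V) →ₗ[ℂ] EuclideanSpace ℂ (Fin d × V) :=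
  Matrix.toEuclideanLin (Matrix.blockDiagonal P)

theorem blockOperator_apply {d : ℕ} (P : V → Matrix (Fin d) (Fin d) ℂ)
    (x : EuclideanSpace ℂ (Fin d × V)) (a : Fin d) (v : V) :
    blockOperator P x (a, v) = ∑ c, P v a c * x (c, v) := by
  rw [blockOperator, Matrix.toLpLin_apply]
  simp only [Matrix.mulVec, dotProduct, Fintype.sum_prod_type, Matrix.blockDiagonal_apply]
  refine Finset.sum_congr rfl fun c _ => ?_
  rw [Finset.sum_eq_single v]
  · simp
  · intro w _ hw; simp [hw.symm]
  · simp

/-- Blocks at adjacent vertices are mapped to orthogonal subspaces of `ℂ ^ d`. -/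
theorem sum_conj_blockOperator_mul {d : ℕ} {P : V → Matrix (Fin d) (Fin d) ℂ} {v w : V}
    (hv : IsStarProjection (P v)) (h : P v * P w = 0) (x : EuclideanSpace ℂ (Fin d × V)) :
    ∑ a, star (blockOperator P x (a, v)) * blockOperator P x (a, w) = 0 := by
  have hx : ∀ u, (fun a => blockOperator P x (a, u)) = (P u).mulVec fun c => x (c, u) :=
    fun u => funext fun a => blockOperator_apply P x a u
  have : ∑ a, star (blockOperator P x (a, v)) * blockOperator P x (a, w) =
      star (fun a => blockOperator P x (a, v)) ⬝ᵥ fun a => blockOperator P x (a, w) := rfl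
  rw [this, hx, hx, Matrix.star_mulVec, ← Matrix.star_eq_conjTranspose, hv.isSelfAdjoint.star_eq,
    ← Matrix.dotProduct_mulVec, Matrix.mulVec_mulVec, h, Matrix.zero_mulVec, dotProduct_zero]

theorem IsProjectiveRepresentation.sum_eigenvalue_mul_norm_sq {d r : ℕ}
    {P : V → Matrix (Fin d) (Fin d) ℂ} (hP : IsProjectiveRepresentation G d r P)
    (x : EuclideanSpace ℂ (Fin d × V)) :
    ∑ m : Fin d × V, eigenvalue G m.2 *
      ‖inner ℂ (tensorEigenvector G d m) (blockOperator P x)‖ ^ 2 = 0 := by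
  set y := blockOperator P x with hy
  have h : ((∑ m : Fin d × V, eigenvalue G m.2 *
      ‖inner ℂ (tensorEigenvector G d m) y‖ ^ 2 : ℝ) : ℂ) =
      ∑ v, ∑ w, ((∑ i, eigenvalue G i * (eigenvectorEntry G v i * eigenvectorEntry G w i) : ℝ) : ℂ)
        * ∑ a, star (y (a, v)) * y (a, w) := by
    push_cast
    have hterm : ∀ (a : Fin d) (i : V), (eigenvalue G i : ℂ) *
        (‖inner ℂ (tensorEigenvector G d (a, i)) y‖ : ℂ) ^ 2 =
        ∑ v, ∑ w, (eigenvalue G i : ℂ) * ((eigenvectorEntry G v i : ℂ) * eigenvectorEntry G w i) *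
          (star (y (a, v)) * y (a, w)) := fun a i => by
      rw [← Complex.conj_mul', inner_tensorEigenvector, map_sum, Finset.sum_mul_sum,
        Finset.mul_sum]
      refine Finset.sum_congr rfl fun v _ => ?_
      rw [Finset.mul_sum]
      refine Finset.sum_congr rfl fun w _ => ?_
      rw [map_mul, Complex.conj_ofReal]
      change _ * (_ * star (y (a, v)) * _) = _
      ring
    simp_rw [Fintype.sum_prod_type, hterm, Finset.sum_mul_sum]
    rw [Finset.sum_comm' (t' := Finset.univ) (s' := fun _ => Finset.univ) (by simp)]
    simp_rw [Finset.sum_comm (s := (Finset.univ : Finset (Fin d))) (t := (Finset.univ : Finset V))]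
    rw [Finset.sum_comm]
    refine Finset.sum_congr rfl fun v _ => ?_
    rw [Finset.sum_comm]
  rw [← Complex.ofReal_eq_zero, h]
  refine Finset.sum_eq_zero fun v _ => Finset.sum_eq_zero fun w _ => ?_
  rw [sum_eigenvalue_mul_eigenvectorEntry]
  split_ifs with hvw
  · rw [hy, sum_conj_blockOperator_mul (hP.proj v) (hP.orthogonal v w hvw), mul_zero]
  · simp

theorem IsProjectiveRepresentation.sum_norm_sq_blockOperator {d r : ℕ}
    {P : V → Matrix (Fin d) (Fin d) ℂ} (hP : IsProjectiveRepresentation G d r P) (i : V) :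
    ∑ a, ‖blockOperator P (tensorEigenvector G d (a, i))‖ ^ 2 = r := by
  have h1 : ∀ a, ‖blockOperator P (tensorEigenvector G d (a, i))‖ ^ 2 =
      ∑ v, eigenvectorEntry G v i ^ 2 * ∑ c, ‖P v c a‖ ^ 2 := fun a => by
    rw [EuclideanSpace.norm_sq_eq, Fintype.sum_prod_type_right]
    refine Finset.sum_congr rfl fun v _ => ?_
    rw [Finset.mul_sum]
    refine Finset.sum_congr rfl fun c _ => ?_
    rw [blockOperator_apply, Finset.sum_eq_single a]
    · simp [tensorEigenvector, mul_pow, mul_comm]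
    · intro c' _ hc'; simp [tensorEigenvector, hc']
    · simp
  have h2 : ∀ v, ∑ a, ∑ c, ‖P v c a‖ ^ 2 = (r : ℝ) := fun v => by
    rw [Finset.sum_comm]
    have := sum_norm_sq_eq_trace_of_isStarProjection (hP.proj v)
    rw [trace_eq_rank_of_isStarProjection (hP.proj v), hP.rank_eq] at this
    exact_mod_cast this
  simp_rw [h1]
  rw [Finset.sum_comm]
  simp_rw [← Finset.mul_sum, h2, ← Finset.sum_mul]
  have := sum_eigenvectorEntry_mul G i i
  simp_rw [if_true, ← sq] at this
  rw [this, one_mul]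

theorem IsProjectiveRepresentation.hasConvexTraceBound {d r : ℕ} (hd : 0 < d)
    {P : V → Matrix (Fin d) (Fin d) ℂ} (hP : IsProjectiveRepresentation G d r P) {l : V → ℝ}
    (hl : l = eigenvalue G ∨ l = -eigenvalue G) : HasConvexTraceBound l (r / d) := by
  intro f hf h0 s hs
  have : NeZero d := ⟨hd.ne'⟩
  have hsymm : (blockOperator P).IsSymmetric := by
    rw [blockOperator, Matrix.isSymmetric_toEuclideanLin_iff, Matrix.IsHermitian,
      Matrix.blockDiagonal_conjTranspose]
    congr 1
    exact funext fun v => (hP.proj v).isSelfAdjoint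
  have hidem : ∀ x, blockOperator P (blockOperator P x) = blockOperator P x := fun x => by
    simp only [blockOperator, Matrix.toLpLin_apply, Matrix.mulVec_mulVec,
      ← Matrix.blockDiagonal_mul]
    congr 3
    exact funext fun v => (hP.proj v).isIdempotentElem
  have key := sum_convex_le_of_projection hf h0 (l := l) hsymm hidem
    (orthonormal_tensorEigenvector G d) hs hP.sum_norm_sq_blockOperator fun x => by
      have hx := hP.sum_eigenvalue_mul_norm_sq x
      rcases hl with rfl | rfl
      · exact hx
      · simp_rw [Pi.neg_apply, neg_mul, Finset.sum_neg_distrib, hx, neg_zero]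
  rwa [Fintype.card_fin] at key

theorem one_add_energyRatio_le_projectiveRank (hG : G ≠ ⊥) {p : ℝ} (hp0 : 0 ≤ p) (hp : p ≠ 1) :
    1 + energyRatio G p ≤ projectiveRank G := by
  obtain ⟨v, -, -⟩ := SimpleGraph.ne_bot_iff_exists_adj.1 hG
  have : Nonempty V := ⟨v⟩
  refine le_csInf (projectiveRank_wellDefined G).1 ?_
  rintro c ⟨d, r, hd, hr, ⟨P, hP⟩, rfl⟩
  have hx := posEnergy_pos G hG p
  have hy := negEnergy_pos G hG p
  rw [energyRatio]
  rw [posEnergy_eq_posPowSum] at hx ⊢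
  rw [negEnergy_eq_posPowSum] at hy ⊢
  have hρ : (0 : ℝ) < r / d := by positivity
  have := (hP.hasConvexTraceBound hd (.inl rfl)).one_add_max_rpow_le
    (hP.hasConvexTraceBound hd (.inr rfl)) hρ hp0 hp hx hy
  rwa [one_div_div] at this

end Representation

/-! ### Comparison of the parameters -/


section Comparison

variable {V : Type*} {G : SimpleGraph V}

/-- A `d/r`-representation indexed by an arbitrary finite type, with the rank given as a trace. -/
theorem projectiveRank_le_card_div {α : Type*} [Fintype V] [Nonempty V] [Fintype α]
    [DecidableEq α] (hα : 0 < Fintype.card α) {r : ℕ} (hr : 0 < r) (P : V → Matrix α α ℂ)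
    (hP : ∀ v, IsStarProjection (P v)) (htr : ∀ v, (P v).trace = r)
    (hadj : ∀ v w, G.Adj v w → P v * P w = 0) :
    projectiveRank G ≤ (Fintype.card α : ℝ) / r := by
  refine csInf_le (projectiveRank_wellDefined G).2
    ⟨_, r, hα, hr, ⟨fun v => (P v).submatrix (Fintype.equivFin α).symm (Fintype.equivFin α).symm,
      fun v => ⟨?_, ?_⟩, fun v => ?_, fun v w h => ?_⟩, rfl⟩
  · rw [IsIdempotentElem, Matrix.submatrix_mul_equiv, (hP v).isIdempotentElem.eq]
  · rw [IsSelfAdjoint, Matrix.star_eq_conjTranspose, Matrix.conjTranspose_submatrix,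
      ← Matrix.star_eq_conjTranspose, (hP v).isSelfAdjoint.star_eq]
  · rw [Matrix.rank_submatrix]
    have := trace_eq_rank_of_isStarProjection (hP v)
    rw [htr] at this
    exact_mod_cast this.symm
  · rw [Matrix.submatrix_mul_equiv, hadj v w h]
    rfl

open Classical in
theorem fractionalChromaticNumber_le_of_coloring [Fintype V] {n : ℕ} (C : G.Coloring (Fin n)) :
    fractionalChromaticNumber G ≤ n := by
  set cls : Finset (Finset V) := Finset.univ.image fun k => Finset.univ.filter fun v => C v = k
    with hcls
  have hsub : cls ⊆ indepSets G := by
    intro J hJ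
    obtain ⟨k, -, rfl⟩ := Finset.mem_image.1 hJ
    simp only [indepSets, Finset.mem_filter, Finset.mem_univ, true_and]
    intro v hv w hw _ h
    simp only [Finset.coe_filter, Finset.mem_univ, true_and, Set.mem_ofPred_eq] at hv hw
    exact C.valid h (hv.trans hw.symm)
  have hle : fractionalChromaticNumber G ≤ ∑ J ∈ indepSets G, if J ∈ cls then (1 : ℝ) else 0 := by
    refine csInf_le (fractionalChromaticNumber_wellDefined G).2
      ⟨_, ⟨fun J _ => ?_, fun v => ?_⟩, rfl⟩
    · split_ifs <;> norm_num
    · have hmem : (Finset.univ.filter fun w => C w = C v) ∈ cls :=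
        Finset.mem_image_of_mem _ (Finset.mem_univ (C v))
      have h := Finset.single_le_sum (f := fun J => if J ∈ cls then (1 : ℝ) else 0)
        (s := (indepSets G).filter (v ∈ ·)) (fun J _ => by split_ifs <;> norm_num)
        (Finset.mem_filter.2 ⟨hsub hmem, by simp⟩)
      simpa only [hmem, if_true] using h
  refine hle.trans ?_
  rw [← Finset.sum_filter, Finset.sum_const, nsmul_one, Nat.cast_le,
    Finset.filter_mem_eq_inter]
  exact (Finset.card_le_card Finset.inter_subset_right).trans
    (Finset.card_image_le.trans (by simp))

theorem quantumChromaticNumber_le_of_coloring {n : ℕ} (C : G.Coloring (Fin n)) :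
    quantumChromaticNumber G ≤ n := by
  refine Nat.sInf_le ⟨1, one_pos, fun v k => if C v = k then 1 else 0,
    ⟨fun v k => ?_, fun v => by simp, fun v w h k => ?_⟩⟩
  · split_ifs
    · exact IsStarProjection.one _
    · exact IsStarProjection.zero _
  · have := C.valid h
    split_ifs with h1 h2
    · exact absurd (h1.trans h2.symm) this
    all_goals simp

theorem orthogonalRank_le_of_coloring [Nonempty V] {n : ℕ} (C : G.Coloring (Fin n)) :
    orthogonalRank G ≤ n := by
  refine Nat.sInf_le ⟨(C (Classical.arbitrary V)).pos, fun v => EuclideanSpace.single (C v) 1,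
    ⟨fun v => by simp, fun v w h => ?_⟩⟩
  have := C.valid h
  simp [EuclideanSpace.inner_single_left, this]

theorem isStarProjection_diagonal_indicator {α : Type*} [Fintype α] [DecidableEq α]
    (S : Finset α) :
    IsStarProjection (Matrix.diagonal fun a => if a ∈ S then (1 : ℂ) else 0) := by
  refine ⟨?_, ?_⟩
  · rw [IsIdempotentElem, Matrix.diagonal_mul_diagonal]
    simp
  · rw [IsSelfAdjoint, Matrix.star_eq_conjTranspose, Matrix.diagonal_conjTranspose]
    congr 1
    ext a
    by_cases h : a ∈ S <;> simp [h]

/-- An assignment of `N`-element subsets of `α`, disjoint on adjacent vertices, gives a projective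
representation by diagonal projectors. -/
theorem projectiveRank_le_of_multicoloring {α : Type*} [Fintype V] [Nonempty V] [Fintype α]
    [DecidableEq α] {N : ℕ} (hN : 0 < N) (S : V → Finset α) (hS : ∀ v, (S v).card = N)
    (hadj : ∀ v w, G.Adj v w → Disjoint (S v) (S w)) :
    projectiveRank G ≤ (Fintype.card α : ℝ) / N := by
  have v₀ := Classical.arbitrary V
  refine projectiveRank_le_card_div ?_ hN
    (fun v => Matrix.diagonal fun a => if a ∈ S v then (1 : ℂ) else 0)
    (fun v => isStarProjection_diagonal_indicator (S v)) (fun v => ?_) fun v w h => ?_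
  · exact (hN.trans_eq (hS v₀).symm).trans_le (Finset.card_le_univ _)
  · rw [Matrix.trace_diagonal]
    simp [hS]
  · rw [Matrix.diagonal_mul_diagonal, ← Matrix.diagonal_zero]
    congr 1
    ext a
    by_cases h1 : a ∈ S v
    · simp [Finset.disjoint_left.1 (hadj v w h) h1]
    · simp [h1]

open Classical in
/-- Rounding `N σ` up to integers turns a fractional coloring into a multicoloring with at least
`N` colors at each vertex. -/
theorem projectiveRank_le_sum_add [Fintype V] [Nonempty V] {σ : Finset V → ℝ}
    (hσ : IsFractionalColoring G σ) {N : ℕ} (hN : 0 < N) :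
    projectiveRank G ≤ ∑ J ∈ indepSets G, σ J + (indepSets G).card / N := by
  set T : Finset ((_ : Finset V) × ℕ) :=
    (indepSets G).sigma fun J => Finset.range ⌈N * σ J⌉₊ with hT
  have hcard : ∀ v, N ≤ (T.filter fun x => v ∈ x.1).card := fun v => by
    have hTv : (T.filter fun x => v ∈ x.1) =
        ((indepSets G).filter (v ∈ ·)).sigma fun J => Finset.range ⌈N * σ J⌉₊ := by
      ext x; simp [hT]; tauto
    rw [hTv, Finset.card_sigma]
    have : (N : ℝ) ≤ ∑ J ∈ indepSets G with v ∈ J, (⌈N * σ J⌉₊ : ℝ) := by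
      calc (N : ℝ) ≤ N * ∑ J ∈ indepSets G with v ∈ J, σ J :=
            le_mul_of_one_le_right (by positivity) (hσ.2 v)
        _ = ∑ J ∈ indepSets G with v ∈ J, N * σ J := Finset.mul_sum _ _ _
        _ ≤ _ := Finset.sum_le_sum fun J _ => Nat.le_ceil _
    simp only [Finset.card_range]
    exact_mod_cast this
  have hex : ∀ v, ∃ S : Finset T, (∀ x ∈ S, v ∈ x.1.1) ∧ S.card = N := fun v => by
    obtain ⟨S, hS, hSN⟩ := Finset.exists_subset_card_eq (hcard v)
    refine ⟨S.subtype (· ∈ T), fun x hx => ?_, ?_⟩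
    · exact (Finset.mem_filter.1 (hS (Finset.mem_subtype.1 hx))).2
    · rw [Finset.card_subtype, Finset.filter_true_of_mem, hSN]
      exact fun x hx => (Finset.mem_filter.1 (hS hx)).1
  choose S hS hSN using hex
  have hle := projectiveRank_le_of_multicoloring (G := G) hN S hSN fun v w h => by
    refine Finset.disjoint_left.2 fun x hv hw => ?_
    have hx := (Finset.mem_sigma.1 x.2).1
    simp only [indepSets, Finset.mem_filter, Finset.mem_univ, true_and] at hx
    exact hx (hS v x hv) (hS w x hw) h.ne h
  refine hle.trans ?_
  rw [Fintype.card_coe, hT, Finset.card_sigma, div_le_iff₀ (by positivity), add_mul,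
    div_mul_cancel₀ _ (by positivity), Finset.sum_mul]
  push_cast
  simp only [Finset.card_range]
  rw [Finset.cast_card, ← Finset.sum_add_distrib]
  refine Finset.sum_le_sum fun J hJ => ?_
  rw [mul_comm (σ J)]
  exact (Nat.ceil_lt_add_one (mul_nonneg (by positivity) (hσ.1 J hJ))).le

theorem projectiveRank_le_fractionalChromaticNumber [Fintype V] [Nonempty V] :
    projectiveRank G ≤ fractionalChromaticNumber G := by
  refine le_csInf (fractionalChromaticNumber_wellDefined G).1 ?_
  rintro c ⟨σ, hσ, rfl⟩
  have hlim : Tendsto (fun N : ℕ => ∑ J ∈ indepSets G, σ J + ((indepSets G).card : ℝ) / N) atTop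
      (𝓝 (∑ J ∈ indepSets G, σ J + 0)) :=
    tendsto_const_nhds.add (tendsto_const_div_atTop_nhds_zero_nat _)
  rw [add_zero] at hlim
  refine ge_of_tendsto hlim ?_
  filter_upwards [eventually_gt_atTop 0] with N hN
  exact projectiveRank_le_sum_add hσ hN

/-- The projectors `⨁ k, P v k` of a quantum `r`-coloring in dimension `d` have rank `d` in
dimension `d * r`. -/
theorem IsQuantumColoring.projectiveRank_le [Fintype V] [Nonempty V] {r d : ℕ} (hd : 0 < d)
    {P : V → Fin r → Matrix (Fin d) (Fin d) ℂ} (hP : IsQuantumColoring G r d P) :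
    projectiveRank G ≤ r := by
  have htr : ∀ v, (Matrix.blockDiagonal (P v)).trace = (d : ℂ) := fun v => by
    rw [Matrix.trace_blockDiagonal, ← Matrix.trace_sum, hP.complete, Matrix.trace_one,
      Fintype.card_fin]
  have hr : 0 < r := by
    rcases Nat.eq_zero_or_pos r with rfl | hr
    · have := htr (Classical.arbitrary V)
      rw [Matrix.trace_blockDiagonal, Finset.univ_eq_empty, Finset.sum_empty] at this
      exact absurd (by exact_mod_cast this) hd.ne
    · exact hr
  have hle := projectiveRank_le_card_div (G := G) (by simp [hd, hr]) hd
    (fun v => Matrix.blockDiagonal (P v)) (fun v => ⟨?_, ?_⟩) htr fun v w h => ?_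
  · refine hle.trans_eq ?_
    rw [Fintype.card_prod, Fintype.card_fin, Fintype.card_fin]
    push_cast
    field_simp
  · rw [IsIdempotentElem, ← Matrix.blockDiagonal_mul]
    congr 1
    exact funext fun k => (hP.proj v k).isIdempotentElem
  · rw [IsSelfAdjoint, Matrix.star_eq_conjTranspose, Matrix.blockDiagonal_conjTranspose]
    congr 1
    exact funext fun k => (hP.proj v k).isSelfAdjoint
  · rw [← Matrix.blockDiagonal_mul, ← Matrix.blockDiagonal_zero]
    congr 1
    exact funext fun k => hP.orthogonal v w h k

/-- The orthogonal projectors onto the lines of an orthogonal representation in dimension `k` form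
a `k/1`-representation. -/
theorem IsOrthogonalRepresentation.projectiveRank_le [Fintype V] [Nonempty V] {k : ℕ}
    (hk : 0 < k) {x : V → EuclideanSpace ℂ (Fin k)} (hx : IsOrthogonalRepresentation G k x) :
    projectiveRank G ≤ k := by
  have hdot : ∀ v w, star (x v).ofLp ⬝ᵥ (x w).ofLp = inner ℂ (x v) (x w) := fun v w => by
    rw [EuclideanSpace.inner_eq_star_dotProduct, dotProduct_comm]
  have hne : ∀ v, inner ℂ (x v) (x v) ≠ 0 := fun v => inner_self_ne_zero.2 (hx.ne_zero v)
  have hmul : ∀ v w, Matrix.vecMulVec (x v).ofLp (star (x v).ofLp) *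
      Matrix.vecMulVec (x w).ofLp (star (x w).ofLp) =
      inner ℂ (x v) (x w) • Matrix.vecMulVec (x v).ofLp (star (x w).ofLp) := fun v w => by
    rw [Matrix.vecMulVec_mul_vecMulVec, hdot, Matrix.vecMulVec_smul]
  have hle := projectiveRank_le_card_div (G := G) (by simpa using hk) one_pos
    (fun v => (inner ℂ (x v) (x v))⁻¹ • Matrix.vecMulVec (x v).ofLp (star (x v).ofLp))
    (fun v => ⟨?_, ?_⟩) (fun v => ?_) fun v w h => ?_
  · simpa using hle
  · rw [IsIdempotentElem, smul_mul_smul_comm, hmul, smul_smul, mul_assoc,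
      inv_mul_cancel₀ (hne v), mul_one]
  · rw [IsSelfAdjoint, star_smul, star_inv₀, Matrix.star_eq_conjTranspose,
      Matrix.conjTranspose_vecMulVec, star_star]
    congr 2
    exact inner_conj_symm (x v) (x v)
  · rw [Matrix.trace_smul, Matrix.trace_vecMulVec, dotProduct_comm, hdot, smul_eq_mul,
      inv_mul_cancel₀ (hne v), Nat.cast_one]
  · rw [smul_mul_smul_comm, hmul, hx.orthogonal v w h, zero_smul, smul_zero]

theorem projectiveRank_le_quantumChromaticNumber [Fintype V] [Nonempty V] :
    projectiveRank G ≤ quantumChromaticNumber G := by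
  obtain ⟨d, hd, P, hP⟩ := Nat.sInf_mem (quantumChromaticNumber_wellDefined G)
  exact IsQuantumColoring.projectiveRank_le hd hP

theorem projectiveRank_le_orthogonalRank [Fintype V] [Nonempty V] :
    projectiveRank G ≤ orthogonalRank G := by
  obtain ⟨hk, x, hx⟩ := Nat.sInf_mem (orthogonalRank_wellDefined G)
  exact IsOrthogonalRepresentation.projectiveRank_le hk hx

end Comparison

end SpectralColoring

open SpectralColoring in
theorem theorem1p3 {V : Type*} [Fintype V] [DecidableEq V] (G : SimpleGraph V)
    [DecidableRel G.Adj] (hG : G ≠ ⊥) (p : ℝ) (hp : 0 ≤ p) :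
    fractionalChromaticNumber G ≤ (G.chromaticNumber.toNat : ℝ) ∧
    quantumChromaticNumber G ≤ G.chromaticNumber.toNat ∧
    orthogonalRank G ≤ G.chromaticNumber.toNat ∧
    projectiveRank G ≤ fractionalChromaticNumber G ∧
    projectiveRank G ≤ (quantumChromaticNumber G : ℝ) ∧
    projectiveRank G ≤ (orthogonalRank G : ℝ) ∧
    (p ≠ 1 → 1 + energyRatio G p ≤ projectiveRank G) ∧
    (p = 1 → ∃ L : ℝ, Tendsto (energyRatio G) (𝓝[≠] 1) (𝓝 L) ∧ 1 + L ≤ projectiveRank G) := by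
  obtain ⟨v, -, -⟩ := SimpleGraph.ne_bot_iff_exists_adj.1 hG
  have : Nonempty V := ⟨v⟩
  obtain ⟨C⟩ := SimpleGraph.colorable_chromaticNumber G.colorable_of_fintype
  refine ⟨fractionalChromaticNumber_le_of_coloring C, quantumChromaticNumber_le_of_coloring C,
    orthogonalRank_le_of_coloring C, projectiveRank_le_fractionalChromaticNumber,
    projectiveRank_le_quantumChromaticNumber, projectiveRank_le_orthogonalRank,
    one_add_energyRatio_le_projectiveRank hG hp, fun _ => ?_⟩
  obtain ⟨L, hL⟩ := exists_tendsto_energyRatio G hG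
  refine ⟨L, hL, le_of_tendsto (hL.const_add 1) ?_⟩
  filter_upwards [self_mem_nhdsWithin, mem_nhdsWithin_of_mem_nhds (lt_mem_nhds one_pos)]
    with q hq hq0
  exact one_add_energyRatio_le_projectiveRank hG (le_of_lt hq0) hq
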